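/- Let $\mathcal C\subset\mathbb C^3$ be an irreducible algebraic curve that is the common zero set of two polynomials $f_1,f_2\in\mathbb R[x_1,x_2,x_3]$, and suppose that every point at infinity of (the projective closure of) $\mathcal C$ has the form $(1:m_2:m_3:0)$. Let $\mathcal C^p\subset\mathbb C^2$ be the (Zariski closed) projection of $\mathcal C$ along the $x_3$-axis, and suppose that this projection is birational, with lift function $h=h_1/h_2$, $h_1,h_2\in\mathbb R[x_1,x_2]$; that is, $h_2$ does not vanish identically on $\mathcal C^p$, and whenever $h_2(x_1,x_2)\neq 0$, one has $(x_1,x_2,x_3)\in\mathcal C$ if and only if $(x_1,x_2)\in\mathcal C^p$ and $x_3=h(x_1,x_2)$. Let $\mathbb C\ll t\gg=\bigcup_{n\ge1}\mathbb C((t^{1/n}))$ be the field of formal Puiseux series. An infinity branch of $\mathcal C$ is a set $B=\{(z,r_2(z),r_3(z)) : z\in\mathbb C,\ |z|>M\}$ with $M>0$ and $r_k(z)=z\,\varphi_k(1/z)$, where $\varphi_2,\varphi_3\in\mathbb C\ll t\gg$ have no terms with negative exponents, the series $r_2(z),r_3(z)$ converge for $|z|>M$, and $B\subset\mathcal C$.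 Here, for each determination of $\log z$, the fractional powers of $z$ in $r_2$ and $r_3$ are taken with respect to that same determination (the different determinations give the conjugates of the branch). An infinity branch $B^p=\{(z,r_2(z)) : |z|>M^p\}$ of $\mathcal C^p$ is defined in the same way, with the coordinate $r_3$ omitted. Theorem. Let $\varphi_2\in\mathbb C\ll t\gg$ and $r_2(z)=z\,\varphi_2(1/z)$. The set $B^p=\{(z,r_2(z)) : |z|>M^p\}$ is an infinity branch of $\mathcal C^p$ for some $M^p>0$ if and only if there are a Puiseux series $r_3(z)=z\,\varphi_3(1/z)$, $\varphi_3\in\mathbb C\ll t\gg$, and some $M>0$ such that $B=\{(z,r_2(z),r_3(z)) : |z|>M\}$ is an infinity branch of $\mathcal C$. Moreover, for every such $r_3$, one has $h_2(z,r_2(z))\neq0$ and $r_3(z)=h(z,r_2(z))$ for all $z$ with $|z|$ sufficiently large. -/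

import Mathlib

open MvPolynomial

noncomputable section

/-! ### Puiseux series -/

/-- The formal Puiseux series `⋃ n ≥ 1, ℂ((t^(1/n)))`: the series `∑ q : ℚ, a q * t ^ q` with
well-ordered support whose exponents have a common denominator `n`. -/
def PuiseuxSeries : Type :=
  {φ : HahnSeries ℚ ℂ // ∃ n : ℕ, 0 < n ∧ ∀ q ∈ φ.support, ∃ k : ℤ, q = (k : ℚ) / (n : ℚ)}

/-- The coefficient of `t ^ q`. -/
def PuiseuxSeries.coeff (φ : PuiseuxSeries) (q : ℚ) : ℂ := φ.1.coeff q

/-- For `φ(t) = ∑ a q * t ^ q`, the term `a q * z ^ (1 - q)` of the series `r(z) = z * φ(1 / z)`.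
Here `l` is a determination of `log z` (so `z = exp l`) and the fractional power `z ^ (1 - q)` is
the one that belongs to it, `exp ((1 - q) * l)`. Another determination of `log z` amounts to
replacing `φ` by a conjugate. -/
def PuiseuxSeries.term (φ : PuiseuxSeries) (l : ℂ) (q : ℚ) : ℂ :=
  φ.coeff q * Complex.exp ((1 - (q : ℂ)) * l)

/-- The value at `z = exp l` of `r(z) = z * φ(1 / z)`
(meaningful where the series converges, i.e. where `φ.term l` is summable). -/
def PuiseuxSeries.eval (φ : PuiseuxSeries) (l : ℂ) : ℂ := ∑' q : ℚ, φ.term l q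

/-! ### Infinity branches, for curves in the plane (`n = 1`) and in space (`n = 2`) -/

/-- The set `{(z, r₁(z), …, rₙ(z)) : |z| > M}` with `r k (z) = z * φ k (1 / z)`; the fractional
powers of `z` in all coordinates belong to one and the same determination `l` of `log z`. -/
def branchSet {n : ℕ} (φ : Fin n → PuiseuxSeries) (M : ℝ) : Set (Fin (n + 1) → ℂ) :=
  {p | ∃ l : ℂ, M < ‖Complex.exp l‖ ∧ p = Fin.cons (Complex.exp l) (fun k => (φ k).eval l)}

/-- `{(z, r₁(z), …, rₙ(z)) : |z| > M}`, with `r k (z) = z * φ k (1 / z)`, is an infinity branch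
of `V`: `M > 0`; the `φ k` have no terms with negative exponents, so that the branch is associated
with the point at infinity `(1 : φ₁(0) : … : φₙ(0) : 0)`; the series converge for `|z| > M`; and the
points of the branch lie on `V`. -/
structure IsInfinityBranch {n : ℕ} (V : Set (Fin (n + 1) → ℂ)) (φ : Fin n → PuiseuxSeries)
    (M : ℝ) : Prop where
  pos : 0 < M
  coeff_eq_zero : ∀ k, ∀ q : ℚ, q < 0 → (φ k).coeff q = 0
  converges : ∀ k, ∀ l : ℂ, M < ‖Complex.exp l‖ → Summable ((φ k).term l)
  subset : branchSet φ M ⊆ V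

/-! ### Curves -/

/-- The common zero set in `ℂ³` of two real polynomials. -/
def spaceLocus (f₁ f₂ : MvPolynomial (Fin 3) ℝ) : Set (Fin 3 → ℂ) :=
  {x | aeval x f₁ = 0 ∧ aeval x f₂ = 0}

/-- An algebraic set `C ⊆ ℂ³` is an irreducible curve: its vanishing ideal is prime, and its
dimension (the transcendence degree over `ℂ` of its coordinate ring) is one. -/
def IsIrreducibleCurve (C : Set (Fin 3 → ℂ)) : Prop :=
  (vanishingIdeal ℂ C).IsPrime ∧
    Algebra.trdeg ℂ (MvPolynomial (Fin 3) ℂ ⧸ vanishingIdeal ℂ C) = 1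

/-- For `v ≠ 0`, the point `(v₁ : v₂ : v₃ : 0)` lies on the projective closure of `C`: the
homogenization of every polynomial vanishing on `C` vanishes there. At last coordinate `0` the
homogenization of `F` is the homogeneous component of `F` of top degree. -/
def IsPointAtInfinity (C : Set (Fin 3 → ℂ)) (v : Fin 3 → ℂ) : Prop :=
  v ≠ 0 ∧ ∀ F ∈ vanishingIdeal ℂ C, aeval v (homogeneousComponent F.totalDegree F) = 0

/-- The plane curve obtained by projecting `C` along the third axis: the Zariski closure in `ℂ²`
of the image of `C` under `(x₁, x₂, x₃) ↦ (x₁, x₂)`. -/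
def projectedCurve (C : Set (Fin 3 → ℂ)) : Set (Fin 2 → ℂ) :=
  zeroLocus ℂ (vanishingIdeal ℂ ((fun x : Fin 3 → ℂ => ![x 0, x 1]) '' C))

/-- `h = h₁ / h₂` is a lift function of `C`, i.e. `(x₁, x₂) ↦ (x₁, x₂, h(x₁, x₂))` is a rational
inverse of the projection of `C` along the third axis: `h₂` does not vanish identically on the
projected curve, and wherever `h₂(x₁, x₂) ≠ 0`, the point `(x₁, x₂, x₃)` is on `C` if and only if
`(x₁, x₂)` is on the projected curve and `x₃ = h(x₁, x₂)`. -/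
structure IsLiftFunction (C : Set (Fin 3 → ℂ)) (h₁ h₂ : MvPolynomial (Fin 2) ℝ) : Prop where
  exists_ne_zero : ∃ y ∈ projectedCurve C, aeval y h₂ ≠ 0
  mem_iff : ∀ x₁ x₂ x₃ : ℂ, aeval ![x₁, x₂] h₂ ≠ 0 →
    (![x₁, x₂, x₃] ∈ C ↔
      ![x₁, x₂] ∈ projectedCurve C ∧ x₃ = aeval ![x₁, x₂] h₁ / aeval ![x₁, x₂] h₂)

end

/-! Let `n` be a common denominator of the exponents of `φ₂` and put `w = exp (-l / n)`, so that `z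
= w⁻ⁿ` and `r₂ = z * g w` with `g` analytic at `0`. Projecting a branch of the curve is immediate.
For the converse, the coordinate ring of the projected curve has transcendence degree at most one,
so modulo its ideal `h₂` divides a nonzero polynomial in `x₁`. Hence `h₂ ≠ 0` on the projected curve
once `|x₁|` is large (`IsIrreducibleCurve.exists_bound_aeval_ne_zero`). The lift property then
forces `r₃ = h₁ / h₂` along the branch, which is also the final claim. This quotient is meromorphic
in `w`. If `r₃ / z` had a pole at `w = 0`, the lifted points would tend to `(0 : 0 : 1 : 0)`, which
is not an admissible point at infinity (`aeval_homogeneousComponent_totalDegree_eq_zero`). So `r₃ /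
z` extends analytically, and its Taylor coefficients are those of `φ₃`. -/

open Filter Topology

/-! ### Zeros of a polynomial on the projected curve -/

/-- In an algebra of transcendence degree at most one, every nonzerodivisor divides a nonzero
polynomial in any given element. -/
theorem exists_polynomial_dvd_aeval {A : Type*} [CommRing A] [Nontrivial A] [Algebra ℂ A]
    (hA : Algebra.trdeg ℂ A ≤ 1) (x h : A) (hh : h ∈ nonZeroDivisors A) :
    ∃ p : Polynomial ℂ, p ≠ 0 ∧ h ∣ Polynomial.aeval x p := by
  by_cases hx : Transcendental ℂ x
  · have hx' : AlgebraicIndependent ℂ (fun _ : Unit => x) :=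
      (algebraicIndependent_unique_type_iff (ι := Unit)).2 hx
    have hind : ¬ AlgebraicIndependent ℂ (fun o : Option Unit => o.elim h fun _ => x) := by
      intro hi
      have h2 := hi.lift_cardinalMk_le_trdeg.trans (Cardinal.lift_le.2 hA)
      simp only [Cardinal.mk_fintype, Fintype.card_option, Fintype.card_unit,
        Cardinal.lift_natCast, Cardinal.lift_one] at h2
      norm_cast at h2
    rw [hx'.option_iff_transcendental, Transcendental, not_not] at hind
    -- `h` is algebraic over `ℂ[x]`. Cancelling powers of the nonzerodivisor `h` makes the constant
    -- coefficient of the relation nonzero, and `h` divides that coefficient.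
    obtain ⟨q, hq0, hq⟩ := hind.exists_nonzero_coeff_and_aeval_eq_zero hh
    have hmem : (q.coeff 0 : A) ∈ Algebra.adjoin ℂ ({x} : Set A) := by
      simpa using (q.coeff 0).2
    obtain ⟨p, hp⟩ := Algebra.adjoin_singleton_eq_range_aeval ℂ x ▸ hmem
    refine ⟨p, ?_, ?_⟩
    · rintro rfl
      exact hq0 (Subtype.ext (by simpa using hp.symm))
    · rw [show Polynomial.aeval x p = (q.coeff 0 : A) from hp]
      rw [← Polynomial.divX_mul_X_add q] at hq
      simp only [map_add, map_mul, Polynomial.aeval_X, Polynomial.aeval_C] at hq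
      change _ + (q.coeff 0 : A) = 0 at hq
      exact ⟨-Polynomial.aeval h q.divX, by linear_combination hq⟩
  · rw [Transcendental, not_not] at hx
    obtain ⟨p, hp, hpx⟩ := hx
    exact ⟨p, hp, hpx ▸ dvd_zero h⟩

/-- Polynomials in two variables, seen as polynomials in three. -/
noncomputable def planeInclusion : MvPolynomial (Fin 2) ℂ →ₐ[ℂ] MvPolynomial (Fin 3) ℂ :=
  aeval ![X 0, X 1]

theorem aeval_planeInclusion (x : Fin 3 → ℂ) (p : MvPolynomial (Fin 2) ℂ) :
    aeval x (planeInclusion p) = aeval ![x 0, x 1] p := by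
  rw [planeInclusion, ← AlgHom.comp_apply, comp_aeval]
  congr 2
  funext i
  fin_cases i <;> simp

theorem vanishingIdeal_projection (C : Set (Fin 3 → ℂ)) :
    vanishingIdeal ℂ ((fun x : Fin 3 → ℂ => ![x 0, x 1]) '' C) =
      (vanishingIdeal ℂ C).comap planeInclusion := by
  ext p
  simp [mem_vanishingIdeal_iff, aeval_planeInclusion]

theorem projection_mem_projectedCurve {C : Set (Fin 3 → ℂ)} {x : Fin 3 → ℂ} (hx : x ∈ C) :
    ![x 0, x 1] ∈ projectedCurve C :=
  zeroLocus_vanishingIdeal_le _ ⟨x, hx, rfl⟩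

/-- A polynomial that does not vanish identically on the projection of an irreducible curve
vanishes there at no point with large first coordinate. -/
theorem IsIrreducibleCurve.exists_bound_aeval_ne_zero {C : Set (Fin 3 → ℂ)}
    (hC : IsIrreducibleCurve C) (h : MvPolynomial (Fin 2) ℂ)
    (hh : ∃ y ∈ projectedCurve C, aeval y h ≠ 0) :
    ∃ R : ℝ, ∀ y ∈ projectedCurve C, R < ‖y 0‖ → aeval y h ≠ 0 := by
  obtain ⟨hprime, htr⟩ := hC
  set I := vanishingIdeal ℂ ((fun x : Fin 3 → ℂ => ![x 0, x 1]) '' C) with hI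
  have hIc : I = (vanishingIdeal ℂ C).comap planeInclusion := vanishingIdeal_projection C
  have hIp : I.IsPrime := hIc ▸ Ideal.comap_isPrime _ _
  have hle : Algebra.trdeg ℂ (MvPolynomial (Fin 2) ℂ ⧸ I) ≤ 1 := by
    rw [← htr]
    exact trdeg_le_of_injective
      (Ideal.quotientMapₐ (vanishingIdeal ℂ C) planeInclusion hIc.le)
      (Ideal.quotientMap_injective' (H := hIc.le) hIc.ge)
  have hne : Ideal.Quotient.mk I h ≠ 0 := by
    obtain ⟨y, hy, hyh⟩ := hh
    rw [Ne, Ideal.Quotient.eq_zero_iff_mem]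
    exact fun hmem => hyh (hy h hmem)
  obtain ⟨p, hp, b, hb⟩ := exists_polynomial_dvd_aeval hle (Ideal.Quotient.mk I (X 0)) _
    (mem_nonZeroDivisors_of_ne_zero hne)
  obtain ⟨b, rfl⟩ := Ideal.Quotient.mk_surjective b
  have hmem : Polynomial.aeval (X 0 : MvPolynomial (Fin 2) ℂ) p - h * b ∈ I := by
    rw [← Ideal.Quotient.eq_zero_iff_mem, map_sub, map_mul, sub_eq_zero, ← hb]
    exact (Polynomial.aeval_algHom_apply (Ideal.Quotient.mkₐ ℂ I) (X 0) p).symm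
  -- At a zero of `h` on the projected curve, the first coordinate is one of the finitely many roots
  -- of `p`.
  obtain ⟨R, hR⟩ := (p.rootSet_finite ℂ).isBounded.exists_norm_le
  refine ⟨R, fun y hy hyR h0 => hyR.not_ge (hR _ ?_)⟩
  have hv := hy _ hmem
  rw [map_sub, map_mul, h0, zero_mul, sub_zero, ← Polynomial.aeval_algHom_apply, aeval_X] at hv
  exact (Polynomial.mem_rootSet).2 ⟨hp, hv⟩

/-! ### Limits of points at infinity -/

theorem isHomogeneous_aeval_mul {σ : Type*} {F : MvPolynomial σ ℂ} {d : ℕ}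
    (hF : F.IsHomogeneous d) (c : ℂ) (u : σ → ℂ) :
    aeval (fun i => c * u i) F = c ^ d * aeval u F := by
  rw [aeval_def, aeval_def, eval₂_eq, eval₂_eq, Finset.mul_sum]
  refine Finset.sum_congr rfl fun m hm => ?_
  rw [← hF (mem_support_iff.1 hm)]
  simp only [mul_pow, Finset.prod_mul_distrib, Finset.prod_pow_eq_pow_sum]
  rw [Finsupp.weight_apply, Finsupp.sum]
  simp only [Pi.one_apply, smul_eq_mul, mul_one]
  ring

/-- If `F` vanishes at points `c * u` with `c → ∞` and `u → v`, then its top homogeneous component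
vanishes at `v`. -/
theorem aeval_homogeneousComponent_totalDegree_eq_zero {σ α : Type*} {l : Filter α} [l.NeBot]
    (F : MvPolynomial σ ℂ) (c : α → ℂ) (u : α → σ → ℂ) (v : σ → ℂ)
    (hc : Tendsto c l (Bornology.cobounded ℂ)) (hu : Tendsto u l (𝓝 v))
    (h0 : ∀ᶠ a in l, aeval (fun i => c a * u a i) F = 0) :
    aeval v (homogeneousComponent F.totalDegree F) = 0 := by
  set d := F.totalDegree with hd
  have hcont (G : MvPolynomial σ ℂ) : Tendsto (fun a => aeval (u a) G) l (𝓝 (aeval v G)) := by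
    simp only [aeval_eq_eval]
    exact (MvPolynomial.continuous_eval G).continuousAt.tendsto.comp hu
  have hci : Tendsto (fun a => (c a)⁻¹) l (𝓝 0) := tendsto_inv₀_cobounded.comp hc
  -- After division by `c ^ d`, the component of degree `i` carries the factor `c⁻¹ ^ (d - i)`, so
  -- only the top one survives in the limit.
  have hlim : Tendsto (fun a => ∑ i ∈ Finset.range (d + 1),
      (c a)⁻¹ ^ (d - i) * aeval (u a) (homogeneousComponent i F)) l
      (𝓝 (∑ i ∈ Finset.range (d + 1), 0 ^ (d - i) * aeval v (homogeneousComponent i F))) :=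
    tendsto_finsetSum _ fun i _ => (hci.pow _).mul (hcont _)
  have hval : ∑ i ∈ Finset.range (d + 1), (0 : ℂ) ^ (d - i) * aeval v (homogeneousComponent i F)
      = aeval v (homogeneousComponent d F) := by
    rw [Finset.sum_range_succ, Finset.sum_eq_zero, Nat.sub_self, pow_zero, one_mul, zero_add]
    intro i hi
    rw [zero_pow (by have := Finset.mem_range.1 hi; omega), zero_mul]
  rw [hval] at hlim
  refine tendsto_nhds_unique hlim (tendsto_const_nhds.congr' ?_)
  filter_upwards [h0, hc.eventually_ne_cobounded 0] with a ha hca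
  have hsum : ∑ i ∈ Finset.range (d + 1),
      c a ^ i * aeval (u a) (homogeneousComponent i F) = 0 := by
    rw [← ha]
    conv_rhs => rw [← sum_homogeneousComponent F]
    rw [map_sum]
    exact Finset.sum_congr rfl fun i _ =>
      (isHomogeneous_aeval_mul (homogeneousComponent_isHomogeneous i F) _ _).symm
  rw [← mul_zero ((c a)⁻¹ ^ d), ← hsum, Finset.mul_sum]
  refine Finset.sum_congr rfl fun i hi => ?_
  obtain ⟨k, hk⟩ := Nat.exists_eq_add_of_le (Nat.lt_succ_iff.1 (Finset.mem_range.1 hi))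
  rw [hk, Nat.add_sub_cancel_left, pow_add, inv_pow, inv_pow]
  field_simp

/-! ### Puiseux series as power series in `w = exp (-l / n)` -/

/-- All exponents of the Puiseux series are of the form `k / n` with `k` a natural number. -/
def PuiseuxSeries.HasDenominator (φ : PuiseuxSeries) (n : ℕ) : Prop :=
  ∀ q : ℚ, φ.coeff q ≠ 0 → ∃ k : ℕ, (k : ℚ) / n = q

theorem PuiseuxSeries.exists_hasDenominator (φ : PuiseuxSeries)
    (h0 : ∀ q : ℚ, q < 0 → φ.coeff q = 0) : ∃ n : ℕ, 0 < n ∧ φ.HasDenominator n := by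
  obtain ⟨n, hn, h⟩ := φ.2
  refine ⟨n, hn, fun q hq => ?_⟩
  obtain ⟨k, rfl⟩ := h q hq
  have hk : 0 ≤ k := by
    by_contra! hk
    exact hq (h0 _ (div_neg_of_neg_of_pos (by exact_mod_cast hk) (by exact_mod_cast hn)))
  lift k to ℕ using hk
  exact ⟨k, by simp⟩

theorem natCast_div_injective {n : ℕ} (hn : 0 < n) :
    Function.Injective fun k : ℕ => (k : ℚ) / n := by
  intro j k h
  have hn' : (n : ℚ) ≠ 0 := by positivity
  exact_mod_cast (div_left_inj' hn').1 h

theorem PuiseuxSeries.term_natCast_div (φ : PuiseuxSeries) (n k : ℕ) (l : ℂ) :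
    φ.term l ((k : ℚ) / n) =
      Complex.exp l * (φ.coeff ((k : ℚ) / n) * Complex.exp (-l / n) ^ k) := by
  rw [PuiseuxSeries.term, ← Complex.exp_nat_mul, mul_left_comm, ← Complex.exp_add]
  congr 2
  push_cast
  ring

theorem PuiseuxSeries.HasDenominator.term_eq_zero {φ : PuiseuxSeries} {n : ℕ}
    (h : φ.HasDenominator n) (l : ℂ) (q : ℚ) (hq : q ∉ Set.range fun k : ℕ => (k : ℚ) / n) :
    φ.term l q = 0 := by
  have : φ.coeff q = 0 := by
    by_contra hc
    exact hq (h q hc)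
  rw [PuiseuxSeries.term, this, zero_mul]

theorem PuiseuxSeries.HasDenominator.summable_term_iff {φ : PuiseuxSeries} {n : ℕ}
    (h : φ.HasDenominator n) (hn : 0 < n) (l : ℂ) :
    Summable (φ.term l) ↔
      Summable fun k : ℕ => φ.coeff ((k : ℚ) / n) * Complex.exp (-l / n) ^ k := by
  rw [← (natCast_div_injective hn).summable_iff (h.term_eq_zero l)]
  simp only [Function.comp_def, PuiseuxSeries.term_natCast_div]
  exact summable_mul_left_iff (Complex.exp_ne_zero l)

theorem PuiseuxSeries.HasDenominator.eval_eq {φ : PuiseuxSeries} {n : ℕ}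
    (h : φ.HasDenominator n) (hn : 0 < n) (l : ℂ) :
    φ.eval l =
      Complex.exp l * ∑' k : ℕ, φ.coeff ((k : ℚ) / n) * Complex.exp (-l / n) ^ k := by
  rw [PuiseuxSeries.eval, ← (natCast_div_injective hn).tsum_eq, ← tsum_mul_left]
  · simp only [PuiseuxSeries.term_natCast_div]
  · intro q hq
    by_contra hc
    exact hq (h.term_eq_zero l q hc)

/-- The order embedding `k ↦ k / n` of `ℕ` into `ℚ`. -/
def natDivEmbedding (n : ℕ) (hn : 0 < n) : ℕ ↪o ℚ :=
  OrderEmbedding.ofStrictMono (fun k : ℕ => (k : ℚ) / n) fun j k hjk =>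
    div_lt_div_of_pos_right (by exact_mod_cast hjk) (by exact_mod_cast hn)

/-- The Puiseux series `∑ b k * t ^ (k / n)`. -/
noncomputable def PuiseuxSeries.ofCoeffs (n : ℕ) (hn : 0 < n) (b : ℕ → ℂ) : PuiseuxSeries :=
  ⟨HahnSeries.embDomain (natDivEmbedding n hn) (HahnSeries.toPowerSeries.symm (PowerSeries.mk b)),
    n, hn, fun q hq => by
      obtain ⟨k, -, rfl⟩ := HahnSeries.support_embDomain_subset hq
      exact ⟨k, rfl⟩⟩

theorem PuiseuxSeries.coeff_ofCoeffs (n : ℕ) (hn : 0 < n) (b : ℕ → ℂ) (k : ℕ) :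
    (PuiseuxSeries.ofCoeffs n hn b).coeff ((k : ℚ) / n) = b k := by
  refine (HahnSeries.embDomain_coeff (f := natDivEmbedding n hn) (a := k)).trans ?_
  simp

theorem PuiseuxSeries.hasDenominator_ofCoeffs (n : ℕ) (hn : 0 < n) (b : ℕ → ℂ) :
    (PuiseuxSeries.ofCoeffs n hn b).HasDenominator n := fun q hq => by
  obtain ⟨k, -, rfl⟩ := HahnSeries.support_embDomain_subset hq
  exact ⟨k, rfl⟩

theorem PuiseuxSeries.HasDenominator.coeff_eq_zero {φ : PuiseuxSeries} {n : ℕ}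
    (h : φ.HasDenominator n) (q : ℚ) (hq : q < 0) : φ.coeff q = 0 := by
  by_contra hc
  obtain ⟨k, rfl⟩ := h q hc
  exact hq.not_ge (by positivity)

/-- Summability at a single nonzero point already bounds the radius of convergence below by `‖w₀‖`.
-/
theorem analyticAt_tsum_mul_pow {a : ℕ → ℂ} {w₀ : ℂ} (hw₀ : w₀ ≠ 0)
    (hs : Summable fun k => a k * w₀ ^ k) : AnalyticAt ℂ (fun w => ∑' k, a k * w ^ k) 0 := by
  have hr : (‖w₀‖₊ : ENNReal) ≤ (FormalMultilinearSeries.ofScalars ℂ a).radius := by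
    refine FormalMultilinearSeries.le_radius_of_summable _ ?_
    simpa [FormalMultilinearSeries.ofScalars_norm] using hs.norm
  have hpos : 0 < (FormalMultilinearSeries.ofScalars ℂ a).radius :=
    lt_of_lt_of_le (by simpa using hw₀) hr
  have hsum := (FormalMultilinearSeries.hasFPowerSeriesOnBall _ hpos).analyticAt
  refine hsum.congr (Eventually.of_forall fun w => ?_)
  exact FormalMultilinearSeries.ofScalars_sum_eq a w

theorem AnalyticAt.exists_hasSum_mul_pow {g : ℂ → ℂ} (hg : AnalyticAt ℂ g 0) :
    ∃ b : ℕ → ℂ, ∀ᶠ w in 𝓝 0, HasSum (fun k => b k * w ^ k) (g w) := by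
  obtain ⟨p, hp⟩ := hg
  refine ⟨p.coeff, ?_⟩
  filter_upwards [hp.eventually_hasSum] with w hw
  simpa [mul_comm] using hw

theorem exp_neg_div_pow {n : ℕ} (hn : 0 < n) (l : ℂ) :
    (Complex.exp (-l / n) ^ n)⁻¹ = Complex.exp l := by
  have hn' : (n : ℂ) ≠ 0 := by exact_mod_cast hn.ne'
  rw [← Complex.exp_nat_mul, mul_div_cancel₀ _ hn', Complex.exp_neg, inv_inv]

theorem exists_exp_neg_div_eq {n : ℕ} (hn : 0 < n) {w : ℂ} (hw : w ≠ 0) :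
    ∃ l : ℂ, Complex.exp (-l / n) = w := by
  have hn' : (n : ℂ) ≠ 0 := by exact_mod_cast hn.ne'
  refine ⟨-(n * Complex.log w), ?_⟩
  rw [neg_neg, mul_div_cancel_left₀ _ hn', Complex.exp_log hw]

theorem tendsto_inv_pow_cobounded {n : ℕ} (hn : 0 < n) :
    Tendsto (fun w : ℂ => (w ^ n)⁻¹) (𝓝[≠] 0) (Bornology.cobounded ℂ) := by
  refine tendsto_inv₀_nhdsNE_zero.comp (tendsto_nhdsWithin_iff.2 ⟨?_, ?_⟩)
  · have : Tendsto (fun w : ℂ => w ^ n) (𝓝 0) (𝓝 (0 ^ n)) := (continuous_pow n).continuousAt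
    rw [zero_pow hn.ne'] at this
    exact this.mono_left nhdsWithin_le_nhds
  · filter_upwards [self_mem_nhdsWithin] with w hw
    exact pow_ne_zero n hw

/-- A property of all small `w ≠ 0` holds at `w = exp (-l / n)` when `exp l` is large. -/
theorem exists_bound_of_eventually_nhdsNE {n : ℕ} (hn : 0 < n) {p : ℂ → Prop}
    (hp : ∀ᶠ w in 𝓝[≠] 0, p w) :
    ∃ M : ℝ, 0 < M ∧ ∀ l : ℂ, M < ‖Complex.exp l‖ → p (Complex.exp (-l / n)) := by
  rw [eventually_nhdsWithin_iff, Metric.eventually_nhds_iff] at hp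
  obtain ⟨ε, hε, h⟩ := hp
  refine ⟨(ε ^ n)⁻¹, by positivity, fun l hl => h ?_ (Complex.exp_ne_zero _)⟩
  rw [← exp_neg_div_pow hn l, norm_inv, norm_pow] at hl
  rw [dist_zero_right]
  refine lt_of_pow_lt_pow_left₀ n hε.le ?_
  exact (inv_lt_inv₀ (by positivity) (pow_pos (by simp) n)).1 hl

/-- A property of `exp (-l / n)` for large `exp l` holds for all small `w ≠ 0`. -/
theorem eventually_nhdsNE_of_bound {n : ℕ} (hn : 0 < n) {p : ℂ → Prop} (M : ℝ)
    (h : ∀ l : ℂ, M < ‖Complex.exp l‖ → p (Complex.exp (-l / n))) :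
    ∀ᶠ w in 𝓝[≠] 0, p w := by
  have hM := (tendsto_norm_cobounded_atTop.comp (tendsto_inv_pow_cobounded hn)).eventually_gt_atTop M
  filter_upwards [hM, self_mem_nhdsWithin] with w hw hw0
  obtain ⟨l, rfl⟩ := exists_exp_neg_div_eq hn hw0
  exact h l (by simpa only [Function.comp_apply, exp_neg_div_pow hn] using hw)

/-! ### Projecting and lifting branches -/

theorem meromorphicAt_aeval {σ : Type*} {u : ℂ → σ → ℂ} {x : ℂ}
    (hu : ∀ i, MeromorphicAt (fun w => u w i) x) (F : MvPolynomial σ ℝ) :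
    MeromorphicAt (fun w => aeval (u w) F) x := by
  induction F using MvPolynomial.induction_on with
  | C a => simp
  | add p q hp hq => simpa only [map_add] using hp.fun_add hq
  | mul_X p i hp => simpa only [map_mul, aeval_X] using hp.fun_mul (hu i)

theorem IsInfinityBranch.mem_projectedCurve {C : Set (Fin 3 → ℂ)} {φ₂ : PuiseuxSeries} {M : ℝ}
    (hB : IsInfinityBranch (projectedCurve C) ![φ₂] M) {l : ℂ} (hl : M < ‖Complex.exp l‖) :
    ![Complex.exp l, φ₂.eval l] ∈ projectedCurve C := by
  refine hB.subset ⟨l, hl, ?_⟩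
  funext i
  fin_cases i <;> rfl

theorem IsInfinityBranch.mem_curve {C : Set (Fin 3 → ℂ)} {φ₂ φ₃ : PuiseuxSeries} {M : ℝ}
    (hB : IsInfinityBranch C ![φ₂, φ₃] M) {l : ℂ} (hl : M < ‖Complex.exp l‖) :
    ![Complex.exp l, φ₂.eval l, φ₃.eval l] ∈ C := by
  refine hB.subset ⟨l, hl, ?_⟩
  funext i
  fin_cases i <;> rfl

theorem IsInfinityBranch.projection {C : Set (Fin 3 → ℂ)} {φ₂ φ₃ : PuiseuxSeries} {M : ℝ}
    (hB : IsInfinityBranch C ![φ₂, φ₃] M) : IsInfinityBranch (projectedCurve C) ![φ₂] M where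
  pos := hB.pos
  coeff_eq_zero k := by
    rw [Subsingleton.elim k 0]
    exact hB.coeff_eq_zero 0
  converges k := by
    rw [Subsingleton.elim k 0]
    exact hB.converges 0
  subset := by
    rintro p ⟨l, hl, rfl⟩
    convert projection_mem_projectedCurve (hB.mem_curve hl) using 1
    funext i
    fin_cases i <;> rfl

theorem IsLiftFunction.exists_bound {C : Set (Fin 3 → ℂ)} {h₁ h₂ : MvPolynomial (Fin 2) ℝ}
    (hlift : IsLiftFunction C h₁ h₂) (hcurve : IsIrreducibleCurve C) :
    ∃ R : ℝ, ∀ y ∈ projectedCurve C, R < ‖y 0‖ → aeval y h₂ ≠ 0 := by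
  obtain ⟨y, hy, hy0⟩ := hlift.exists_ne_zero
  simpa only [aeval_map_algebraMap] using
    hcurve.exists_bound_aeval_ne_zero (MvPolynomial.map (algebraMap ℝ ℂ) h₂)
      ⟨y, hy, by rwa [aeval_map_algebraMap]⟩

/-- An infinity branch of the projected curve lifts to an infinity branch of the curve. -/
theorem IsInfinityBranch.exists_lift {C : Set (Fin 3 → ℂ)} (hcurve : IsIrreducibleCurve C)
    (hinf : ∀ v : Fin 3 → ℂ, IsPointAtInfinity C v → v 0 ≠ 0)
    {h₁ h₂ : MvPolynomial (Fin 2) ℝ} (hlift : IsLiftFunction C h₁ h₂) {φ₂ : PuiseuxSeries}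
    {Mp : ℝ} (hB : IsInfinityBranch (projectedCurve C) ![φ₂] Mp) :
    ∃ φ₃ : PuiseuxSeries, ∃ M : ℝ, IsInfinityBranch C ![φ₂, φ₃] M := by
  obtain ⟨R, hR⟩ := hlift.exists_bound hcurve
  obtain ⟨n, hn, hden⟩ := φ₂.exists_hasDenominator (hB.coeff_eq_zero 0)
  set g : ℂ → ℂ := fun w => ∑' k : ℕ, φ₂.coeff ((k : ℚ) / n) * w ^ k with hgdef
  have hg : AnalyticAt ℂ g 0 := by
    obtain ⟨l, hl⟩ : ∃ l : ℂ, Mp < ‖Complex.exp l‖ :=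
      ⟨(Mp : ℂ), by
        rw [Complex.norm_exp, Complex.ofReal_re]
        linarith [Real.add_one_le_exp Mp]⟩
    exact analyticAt_tsum_mul_pow (Complex.exp_ne_zero (-l / n))
      ((hden.summable_term_iff hn l).1 (hB.converges 0 l hl))
  set P : ℂ → Fin 2 → ℂ := fun w => ![(w ^ n)⁻¹, (w ^ n)⁻¹ * g w] with hPdef
  have hPl (l : ℂ) : P (Complex.exp (-l / n)) = ![Complex.exp l, φ₂.eval l] := by
    simp only [hPdef, exp_neg_div_pow hn, hden.eval_eq hn l, hgdef]
  set Q : ℂ → ℂ := fun w => aeval (P w) h₁ / aeval (P w) h₂ with hQdef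
  have hmem : ∀ᶠ w in 𝓝[≠] (0 : ℂ), ![(w ^ n)⁻¹, (w ^ n)⁻¹ * g w, Q w] ∈ C := by
    have : ∀ᶠ w in 𝓝[≠] (0 : ℂ), P w ∈ projectedCurve C ∧ aeval (P w) h₂ ≠ 0 := by
      refine eventually_nhdsNE_of_bound hn (max Mp R) fun l hl => ?_
      rw [hPl]
      have hm := hB.mem_projectedCurve ((le_max_left _ _).trans_lt hl)
      exact ⟨hm, hR _ hm ((le_max_right _ _).trans_lt hl)⟩
    filter_upwards [this] with w hw
    exact (hlift.mem_iff _ _ _ hw.2).2 ⟨hw.1, rfl⟩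
  have hzmer : MeromorphicAt (fun w : ℂ => (w ^ n)⁻¹) 0 := by fun_prop
  have hPmer : ∀ i, MeromorphicAt (fun w => P w i) 0 := by
    intro i
    fin_cases i
    · exact hzmer
    · exact hzmer.mul hg.meromorphicAt
  -- `G` is `r₃ / z`, the candidate for `φ₃` in the parameter `w`.
  set G : ℂ → ℂ := fun w => w ^ n * Q w with hGdef
  have hG : MeromorphicAt G 0 :=
    ((MeromorphicAt.id 0).pow n).mul
      ((meromorphicAt_aeval hPmer h₁).div (meromorphicAt_aeval hPmer h₂))
  have hQG : ∀ᶠ w in 𝓝[≠] (0 : ℂ), Q w = (w ^ n)⁻¹ * G w := by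
    filter_upwards [self_mem_nhdsWithin] with w hw
    rw [hGdef]
    field_simp [show w ≠ 0 from hw]
  have hord : 0 ≤ meromorphicOrderAt G 0 := by
    by_contra! hneg
    have hGc := tendsto_cobounded_of_meromorphicOrderAt_neg hneg
    have hGi : Tendsto (fun w => (G w)⁻¹) (𝓝[≠] 0) (𝓝 0) := tendsto_inv₀_cobounded.comp hGc
    have hQc : Tendsto Q (𝓝[≠] 0) (Bornology.cobounded ℂ) := by
      rw [← tendsto_norm_atTop_iff_cobounded] at hGc ⊢
      have hz := tendsto_norm_atTop_iff_cobounded.2 (tendsto_inv_pow_cobounded hn)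
      refine (hz.atTop_mul_atTop₀ hGc).congr' ?_
      filter_upwards [hQG] with w hw
      exact (norm_mul _ _).symm.trans (congrArg norm hw.symm)
    -- These are the lifted points divided by their third coordinate `Q`, since `z / Q = 1 / G`.
    have hu : Tendsto (fun w => ![(G w)⁻¹, g w * (G w)⁻¹, 1]) (𝓝[≠] 0) (𝓝 ![0, 0, 1]) := by
      rw [tendsto_pi_nhds]
      intro i
      fin_cases i
      · exact hGi
      · simpa using (hg.continuousAt.tendsto.mono_left nhdsWithin_le_nhds).mul hGi
      · exact tendsto_const_nhds
    refine hinf ![0, 0, 1] ⟨fun h => one_ne_zero (congrFun h 2), fun F hF => ?_⟩ rfl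
    refine aeval_homogeneousComponent_totalDegree_eq_zero F Q _ _ hQc hu ?_
    filter_upwards [hmem, hQG, hGc.eventually_ne_cobounded 0] with w hw hwQ hw0
    convert hF _ hw using 2
    congr 1
    funext i
    fin_cases i
    · simp [hwQ, hw0]
    · simp only [hwQ, Fin.mk_one, Matrix.cons_val_one, Matrix.cons_val_zero]
      field_simp
    · simp
  obtain ⟨g₃, hg₃, hGg⟩ := hG.meromorphicOrderAt_nonneg_iff.1 hord
  obtain ⟨b, hb⟩ := hg₃.exists_hasSum_mul_pow
  -- Keeping the denominator `n` of `φ₂` lets both series use the same `w`, hence the same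
  -- determination of the logarithm.
  set φ₃ := PuiseuxSeries.ofCoeffs n hn b
  have hden₃ : φ₃.HasDenominator n := PuiseuxSeries.hasDenominator_ofCoeffs n hn b
  obtain ⟨M, hM0, hM⟩ := exists_bound_of_eventually_nhdsNE hn
    (((hmem.and hQG).and hGg).and (hb.filter_mono nhdsWithin_le_nhds))
  have hsum (l : ℂ) (hl : M < ‖Complex.exp l‖) : HasSum
      (fun k : ℕ => φ₃.coeff ((k : ℚ) / n) * Complex.exp (-l / n) ^ k)
      (g₃ (Complex.exp (-l / n))) := by
    simpa only [φ₃, PuiseuxSeries.coeff_ofCoeffs] using (hM l hl).2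
  refine ⟨φ₃, max Mp M, lt_max_of_lt_right hM0, ?_, ?_, ?_⟩
  · intro k
    fin_cases k
    · exact hB.coeff_eq_zero 0
    · exact hden₃.coeff_eq_zero
  · intro k l hl
    fin_cases k
    · exact hB.converges 0 l ((le_max_left _ _).trans_lt hl)
    · exact (hden₃.summable_term_iff hn l).2 (hsum l ((le_max_right _ _).trans_lt hl)).summable
  · rintro p ⟨l, hl, rfl⟩
    have hl' := (le_max_right _ _).trans_lt hl
    obtain ⟨⟨⟨h1, h2⟩, h3⟩, -⟩ := hM l hl'
    rw [h2, h3, ← (hsum l hl').tsum_eq, exp_neg_div_pow hn, ← hden₃.eval_eq hn l, hgdef,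
      ← hden.eval_eq hn l] at h1
    convert h1 using 1
    funext i
    fin_cases i <;> rfl

theorem mainTheorem1
    (f₁ f₂ : MvPolynomial (Fin 3) ℝ) (C : Set (Fin 3 → ℂ)) (hC : C = spaceLocus f₁ f₂)
    (hcurve : IsIrreducibleCurve C)
    (hinf : ∀ v : Fin 3 → ℂ, IsPointAtInfinity C v → v 0 ≠ 0)
    (h₁ h₂ : MvPolynomial (Fin 2) ℝ) (hlift : IsLiftFunction C h₁ h₂)
    (φ₂ : PuiseuxSeries) :
    ((∃ Mp : ℝ, IsInfinityBranch (projectedCurve C) ![φ₂] Mp) ↔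
      ∃ φ₃ : PuiseuxSeries, ∃ M : ℝ, IsInfinityBranch C ![φ₂, φ₃] M) ∧
    ∀ (φ₃ : PuiseuxSeries) (M : ℝ), IsInfinityBranch C ![φ₂, φ₃] M →
      ∃ M' : ℝ, M ≤ M' ∧ ∀ l : ℂ, M' < ‖Complex.exp l‖ →
        MvPolynomial.aeval ![Complex.exp l, φ₂.eval l] h₂ ≠ 0 ∧
        φ₃.eval l = MvPolynomial.aeval ![Complex.exp l, φ₂.eval l] h₁ /
          MvPolynomial.aeval ![Complex.exp l, φ₂.eval l] h₂ := by
  refine ⟨⟨fun ⟨Mp, hB⟩ => hB.exists_lift hcurve hinf hlift,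
    fun ⟨φ₃, M, hB⟩ => ⟨M, hB.projection⟩⟩, fun φ₃ M hB => ?_⟩
  obtain ⟨R, hR⟩ := hlift.exists_bound hcurve
  refine ⟨max M R, le_max_left _ _, fun l hl => ?_⟩
  have hlM := (le_max_left _ _).trans_lt hl
  have h0 := hR _ (hB.projection.mem_projectedCurve hlM) ((le_max_right _ _).trans_lt hl)
  exact ⟨h0, ((hlift.mem_iff _ _ _ h0).1 (hB.mem_curve hlM)).2⟩
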